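/- Let $S_0,S_1\subset\mathbb{Z}_{\ge 0}$ be nonempty finite sets, and consider the polynomial parameterizations $x=P_0(t)$, $y=P_1(t)$ of plane curves, where $P_i(t)=\sum_{k\in S_i}c_{i,k}t^k\in\mathbb{C}[t]$ has fixed support $S_i$ and generic coefficients. Put $A_i=S_i\cup\{0\}$ and write in ascending order $A_0=\{a_{00}=0,a_{01},\dots,a_{0n}\}$ and $A_1=\{a_{10}=0,a_{11},\dots,a_{1m}\}$. Then there is a nonempty Zariski open (hence open and dense) subset $U$ of the coefficient space $\mathbb{C}^{S_0}\times\mathbb{C}^{S_1}$ such that, for every coefficient vector in $U$ for which the parameterization has degree $[\mathbb{C}(t):\mathbb{C}(P_0,P_1)]=1$, the following holds. The ideal of all $f\in\mathbb{C}[x,y]$ with $f(P_0(t),P_1(t))\equiv 0$ is principal. Let $\phi$ be any generator of it (the implicit equation), and let $N(\phi)\subset\mathbb{R}^2$ be its Newton polygon, i.e. the convex hull of the exponent vectors of the monomials of $\phi$. If $P_0$ or $P_1$ (or both) contains a constant term (that is, $0\in S_0\cup S_1$), then $N(\phi)$ is the triangle with vertices $(0,0),(a_{1m},0),(0,a_{0n})$.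 Otherwise, $N(\phi)$ is the quadrilateral with vertices $(a_{11},0),(a_{1m},0),(0,a_{0n}),(0,a_{01})$. (The polygon may be degenerate, as some of the listed points may coincide.) -/

import Mathlib

/-- The polynomial with exponents in `S` and coefficient vector `c`. -/
noncomputable def polyOf (S : Finset ℕ) (c : S → ℂ) : Polynomial ℂ :=
  ∑ k : S, Polynomial.monomial (k : ℕ) (c k)

/-- A property of coefficient vectors in `ℂ^ι` holds for generic coefficients if it holds on the
complement of the zero set of some nonzero polynomial, i.e. on a nonempty Zariski open subset of
the coefficient space (such a set is open and dense, also in the Euclidean topology). -/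
def HoldsGenerically {ι : Type} (p : (ι → ℂ) → Prop) : Prop :=
  ∃ F : MvPolynomial ι ℂ, F ≠ 0 ∧ ∀ c : ι → ℂ, MvPolynomial.eval c F ≠ 0 → p c

/-- The degree `[ℂ(t) : ℂ(P₀, P₁)]` of the parameterization `x = P₀(t)`, `y = P₁(t)`
(with value `0` if the extension is infinite, i.e. if both polynomials are constant). -/
noncomputable def paramDegree (P₀ P₁ : Polynomial ℂ) : ℕ :=
  Module.finrank
    (IntermediateField.adjoin ℂ
      ({algebraMap (Polynomial ℂ) (RatFunc ℂ) P₀, algebraMap (Polynomial ℂ) (RatFunc ℂ) P₁} :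
        Set (RatFunc ℂ)))
    (RatFunc ℂ)

/-- `φ` is an implicit equation of the curve `x = P₀(t)`, `y = P₁(t)`: it generates the ideal of
all polynomials in `ℂ[x, y]` (`x` is variable `0`, `y` is variable `1`) which vanish
identically after the substitution `x = P₀(t)`, `y = P₁(t)`. -/
def IsImplicitEquation (P₀ P₁ : Polynomial ℂ) (φ : MvPolynomial (Fin 2) ℂ) : Prop :=
  RingHom.ker (MvPolynomial.aeval ![P₀, P₁] : MvPolynomial (Fin 2) ℂ →ₐ[ℂ] Polynomial ℂ) =
    Ideal.span {φ}

/-- The Newton polygon: the convex hull in `ℝ²` of the exponent vectors of `φ`. -/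
def newtonPolygon (φ : MvPolynomial (Fin 2) ℂ) : Set (ℝ × ℝ) :=
  convexHull ℝ ((fun d : Fin 2 →₀ ℕ => ((d 0 : ℝ), (d 1 : ℝ))) '' (φ.support : Set (Fin 2 →₀ ℕ)))

/-- The curve `x = P₀(t)`, `y = P₁(t)` has an implicit equation, and the Newton polygon of any
such equation is the polygon whose set of vertices is `V`. -/
def ImplicitPolygonHasVertices (P₀ P₁ : Polynomial ℂ) (V : Set (ℝ × ℝ)) : Prop :=
  (∃ φ, IsImplicitEquation P₀ P₁ φ) ∧
    ∀ φ, IsImplicitEquation P₀ P₁ φ →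
      newtonPolygon φ = convexHull ℝ V ∧ (newtonPolygon φ).extremePoints ℝ = V

/-
The implicit equation is the resultant of `P(t) - x` and `Q(t) - y` in `t`: it vanishes on the
curve, and its pure power of `x` (or `y`) has the degree of the minimal polynomial of one
coordinate over the field generated by the other. Bounding each entry of the Sylvester matrix by a
row potential plus a column potential bounds the weights of all monomials of the resultant, which
confines its Newton polygon. On the axis `y = 0` the resultant is, up to a constant, the product
of the `P(s) - x` over the roots `s` of `Q`, so its extreme coefficients do not vanish as soon as
`P` and `Q` have no common root `s ≠ 0` (and, in presence of a constant term, none at `0` either).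
This holds off the zero set of one resultant in the coefficients.
-/

open Polynomial
open Finset (range)

section Weights

variable {σ ι R Γ : Type*} [AddCommGroup Γ] [PartialOrder Γ] [IsOrderedAddMonoid Γ]

lemma sum_le_weight_of_mem_support_prod [CommSemiring R] (w : (σ →₀ ℕ) →+ Γ)
    (f : ι → MvPolynomial σ R) (a : ι → Γ) (s : Finset ι)
    (h : ∀ i ∈ s, ∀ d ∈ (f i).support, a i ≤ w d) :
    ∀ d ∈ (∏ i ∈ s, f i).support, ∑ i ∈ s, a i ≤ w d := by
  classical
  induction s using Finset.induction_on with
  | empty =>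
    intro d hd
    rw [Finset.prod_empty, ← MvPolynomial.C_1] at hd
    rw [Finset.mem_singleton.1 (MvPolynomial.support_monomial_subset hd), map_zero,
      Finset.sum_empty]
  | insert i s hi ih =>
    intro d hd
    rw [Finset.prod_insert hi] at hd
    obtain ⟨d₁, h₁, d₂, h₂, rfl⟩ := Finset.mem_add.1 (MvPolynomial.support_mul _ _ hd)
    rw [Finset.sum_insert hi, map_add]
    exact add_le_add (h i (Finset.mem_insert_self _ _) _ h₁)
      (ih (fun j hj => h j (Finset.mem_insert_of_mem hj)) _ h₂)

-- Weak duality for the tropical determinant: `a` and `p` are potentials on columns and rows.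
lemma sum_le_weight_of_mem_support_det [CommRing R] [Fintype ι] [DecidableEq ι]
    (w : (σ →₀ ℕ) →+ Γ) (M : Matrix ι ι (MvPolynomial σ R)) (a p : ι → Γ)
    (h : ∀ i j, ∀ d ∈ (M i j).support, a j ≤ w d + p i) :
    ∀ d ∈ M.det.support, ∑ j, a j ≤ w d + ∑ i, p i := by
  classical
  intro d hd
  rw [Matrix.det_apply] at hd
  obtain ⟨τ, -, hτ⟩ := Finset.mem_biUnion.1 (MvPolynomial.support_sum hd)
  have hprod : d ∈ (∏ j, M (τ j) j).support := by
    rcases Int.units_eq_one_or τ.sign with hs | hs <;> simpa [hs] using hτ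
  have hsum := sum_le_weight_of_mem_support_prod w (fun j => M (τ j) j) (fun j => a j - p (τ j))
    Finset.univ (fun j _ e he => sub_le_iff_le_add.2 (h (τ j) j e he)) d hprod
  rwa [Finset.sum_sub_distrib, Equiv.sum_comp τ p, sub_le_iff_le_add] at hsum

lemma sum_le_weight_of_mem_support_resultant [CommRing R] (w : (σ →₀ ℕ) →+ Γ)
    (f g : (MvPolynomial σ R)[X]) (n m : ℕ) (a b p : ℕ → Γ)
    (hf : ∀ j < m, ∀ k ≤ n, ∀ d ∈ (f.coeff k).support, a j ≤ w d + p (j + k))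
    (hg : ∀ j < n, ∀ k ≤ m, ∀ d ∈ (g.coeff k).support, b j ≤ w d + p (j + k)) :
    ∀ d ∈ (resultant f g n m).support,
      ∑ j ∈ range n, b j + ∑ j ∈ range m, a j ≤ w d + ∑ i ∈ range (n + m), p i := by
  intro d hd
  have hdet := sum_le_weight_of_mem_support_det w (sylvester f g n m)
    (fun j => j.addCases (fun j => b j) (fun j => a j)) (fun i => p i) ?_ d hd
  · simpa only [Fin.sum_univ_add, Finset.sum_range, Fin.addCases_left, Fin.addCases_right]
      using hdet
  · intro i j e he
    induction j using Fin.addCases with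
    | left j =>
      simp only [sylvester, Matrix.of_apply, Fin.addCases_left] at he ⊢
      split_ifs at he with hij
      · simpa only [Nat.add_sub_cancel' hij.1] using hg j j.2 (i - j) (by grind) e he
      · simp at he
    | right j =>
      simp only [sylvester, Matrix.of_apply, Fin.addCases_right] at he ⊢
      split_ifs at he with hij
      · simpa only [Nat.add_sub_cancel' hij.1] using hf j j.2 (i - j) (by grind) e he
      · simp at he

end Weights

section Support

variable {R : Type*} [CommRing R] {P Q : R[X]} {d : Fin 2 →₀ ℕ}

/-- The resultant `Res_t(P(t) - x, Q(t) - y)` in `R[x, y]`, taken with respect to the degrees of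
`P` and `Q`; here `x` is variable `0` and `y` is variable `1`. -/
noncomputable def implicitResultant (P Q : R[X]) : MvPolynomial (Fin 2) R :=
  resultant (P.map MvPolynomial.C - C (MvPolynomial.X 0))
    (Q.map MvPolynomial.C - C (MvPolynomial.X 1)) P.natDegree Q.natDegree

lemma mem_support_coeff_map_C_sub {σ : Type*} {i : σ} {k : ℕ} {d : σ →₀ ℕ}
    (hd : d ∈ ((P.map MvPolynomial.C - C (MvPolynomial.X i)).coeff k).support) :
    (d = 0 ∧ P.coeff k ≠ 0) ∨ (k = 0 ∧ d = Finsupp.single i 1) := by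
  classical
  rw [coeff_sub, coeff_map, coeff_C] at hd
  rcases Finset.mem_union.1 (MvPolynomial.support_sub _ _ _ hd) with h | h
  · rw [MvPolynomial.support_C] at h
    grind
  · split_ifs at h with hk
    · exact .inr ⟨hk, Finset.mem_singleton.1 (MvPolynomial.support_monomial_subset h)⟩
    · simp at h

/-- The additive weight `(d₀, d₁) ↦ u * d₀ + v * d₁` on exponent vectors in the plane. -/
def planeWeight (u v : ℤ) : (Fin 2 →₀ ℕ) →+ ℤ where
  toFun d := u * d 0 + v * d 1
  map_zero' := by simp
  map_add' d e := by
    simp only [Finsupp.add_apply, Nat.cast_add]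
    ring

lemma sum_le_weight_of_mem_support_implicitResultant (u v : ℤ) (a b p : ℕ → ℤ)
    (hP : ∀ j < Q.natDegree, a j ≤ u + p j ∧
      ∀ k ≤ P.natDegree, P.coeff k ≠ 0 → a j ≤ p (j + k))
    (hQ : ∀ j < P.natDegree, b j ≤ v + p j ∧
      ∀ k ≤ Q.natDegree, Q.coeff k ≠ 0 → b j ≤ p (j + k))
    (hd : d ∈ (implicitResultant P Q).support) :
    ∑ j ∈ range P.natDegree, b j + ∑ j ∈ range Q.natDegree, a j ≤
      u * d 0 + v * d 1 + ∑ i ∈ range (P.natDegree + Q.natDegree), p i := by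
  refine sum_le_weight_of_mem_support_resultant (planeWeight u v) _ _ _ _ a b p ?_ ?_ d hd
  · intro j hj k hk e he
    rcases mem_support_coeff_map_C_sub he with ⟨rfl, h⟩ | ⟨rfl, rfl⟩
    · simpa using (hP j hj).2 k hk h
    · simpa [planeWeight] using (hP j hj).1
  · intro j hj k hk e he
    rcases mem_support_coeff_map_C_sub he with ⟨rfl, h⟩ | ⟨rfl, rfl⟩
    · simpa using (hQ j hj).2 k hk h
    · simpa [planeWeight] using (hQ j hj).1

lemma fst_le_natDegree_of_mem_support (hd : d ∈ (implicitResultant P Q).support) :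
    d 0 ≤ Q.natDegree := by
  have := sum_le_weight_of_mem_support_implicitResultant (-1) 0 (fun _ => -1) (fun _ => 0)
    (fun _ => 0) (by simp) (by simp) hd
  simp only [Finset.sum_const, Finset.card_range, nsmul_eq_mul] at this
  omega

lemma snd_le_natDegree_of_mem_support (hd : d ∈ (implicitResultant P Q).support) :
    d 1 ≤ P.natDegree := by
  have := sum_le_weight_of_mem_support_implicitResultant 0 (-1) (fun _ => 0) (fun _ => -1)
    (fun _ => 0) (by simp) (by simp) hd
  simp only [Finset.sum_const, Finset.card_range, nsmul_eq_mul] at this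
  omega

lemma weight_le_mul_of_mem_support (hd : d ∈ (implicitResultant P Q).support) :
    P.natDegree * d 0 + Q.natDegree * d 1 ≤ P.natDegree * Q.natDegree := by
  have := sum_le_weight_of_mem_support_implicitResultant (-P.natDegree) (-Q.natDegree)
    (fun j => -P.natDegree - j) (fun j => -Q.natDegree - j) (fun i => -i)
    (fun j _ => ⟨by linarith, fun k hk _ => by push_cast; omega⟩)
    (fun j _ => ⟨by linarith, fun k hk _ => by push_cast; omega⟩) hd
  simp only [Finset.sum_range_add, Finset.sum_sub_distrib, Finset.sum_neg_distrib,
    Finset.sum_const, Finset.card_range, Nat.cast_add, Finset.sum_add_distrib,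
    nsmul_eq_mul] at this
  zify
  linarith

lemma two_mul_sum_range_tsub {a n : ℕ} (h : a ≤ n) :
    2 * ∑ j ∈ range n, (a - j) = a * (a + 1) := by
  induction n generalizing a with
  | zero => simp [Nat.le_zero.1 h]
  | succ n ih =>
    cases a with
    | zero => simp
    | succ a =>
      simp only [Finset.sum_range_succ', Nat.add_sub_add_right, mul_add,
        ih (Nat.le_of_succ_le_succ h)]
      simp only [Nat.sub_zero]
      ring

lemma mul_le_weight_of_mem_support {a b : ℕ} (ha : a ≤ P.natDegree) (hb : b ≤ Q.natDegree)
    (hP : X ^ a ∣ P) (hQ : X ^ b ∣ Q) (hd : d ∈ (implicitResultant P Q).support) :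
    a * b ≤ a * d 0 + b * d 1 := by
  rw [X_pow_dvd_iff] at hP hQ
  have := sum_le_weight_of_mem_support_implicitResultant a b
    (fun j => -(b - j : ℕ)) (fun j => -(a - j : ℕ)) (fun i => -(a + b - i : ℕ))
    (fun j _ => ⟨by omega, fun k _ hk => by
      have : a ≤ k := not_lt.1 fun h => hk (hP k h)
      omega⟩)
    (fun j _ => ⟨by omega, fun k _ hk => by
      have : b ≤ k := not_lt.1 fun h => hk (hQ k h)
      omega⟩) hd
  rw [Finset.sum_neg_distrib, Finset.sum_neg_distrib, Finset.sum_neg_distrib] at this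
  have ha' := two_mul_sum_range_tsub ha
  have hb' := two_mul_sum_range_tsub hb
  have hab := two_mul_sum_range_tsub (add_le_add ha hb)
  zify at ha' hb' hab ⊢
  linarith

end Support

section Axes

section CommRing

variable {R A : Type*} [CommRing R] [CommRing A] [Algebra R A] {P Q : R[X]}

lemma map_implicitResultant (f : MvPolynomial (Fin 2) R →ₐ[R] A) (P Q : R[X]) :
    f (implicitResultant P Q) =
      resultant (P.map (algebraMap R A) - C (f (MvPolynomial.X 0)))
        (Q.map (algebraMap R A) - C (f (MvPolynomial.X 1))) P.natDegree Q.natDegree := by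
  have hC : (f : MvPolynomial (Fin 2) R →+* A).comp MvPolynomial.C = algebraMap R A :=
    f.comp_algebraMap
  have hmap := resultant_map_map (P.map MvPolynomial.C - C (MvPolynomial.X 0))
    (Q.map MvPolynomial.C - C (MvPolynomial.X 1)) P.natDegree Q.natDegree
    (f : MvPolynomial (Fin 2) R →+* A)
  rw [Polynomial.map_sub, Polynomial.map_sub, Polynomial.map_map, Polynomial.map_map, hC, map_C,
    map_C] at hmap
  exact hmap.symm

lemma natDegree_map_sub_C_le (P : R[X]) (r : A) :
    (P.map (algebraMap R A) - C r).natDegree ≤ P.natDegree :=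
  natDegree_sub_C.trans_le natDegree_map_le

-- `P(s) - P(t)` and `Q(s) - Q(t)`, as polynomials in `s`, have the common root `s = t`.
lemma aeval_implicitResultant (h : P.natDegree ≠ 0 ∨ Q.natDegree ≠ 0) :
    MvPolynomial.aeval ![P, Q] (implicitResultant P Q) = 0 := by
  obtain ⟨p, q, -, -, hpq⟩ := exists_mul_add_mul_eq_C_resultant
    (P.map (algebraMap R R[X]) - C P) (Q.map (algebraMap R R[X]) - C Q)
    (natDegree_map_sub_C_le P P) (natDegree_map_sub_C_le Q Q) h
  have hroot (F : R[X]) : eval X (F.map (algebraMap R R[X]) - C F) = 0 := by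
    rw [eval_sub, eval_C, eval_map_algebraMap, aeval_X_left_apply, sub_self]
  have heval := congrArg (eval X) hpq
  rw [eval_C, eval_add, eval_mul, eval_mul, hroot, hroot, zero_mul, zero_mul, add_zero] at heval
  rw [map_implicitResultant, MvPolynomial.aeval_X, MvPolynomial.aeval_X]
  exact heval.symm

lemma coeff_aeval_single {σ : Type*} [DecidableEq σ] (i : σ) (F : MvPolynomial σ R) (k : ℕ) :
    (MvPolynomial.aeval (Pi.single i (X : R[X])) F).coeff k = F.coeff (Finsupp.single i k) := by
  induction F using MvPolynomial.induction_on' with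
  | add p q hp hq => rw [map_add, coeff_add, hp, hq, MvPolynomial.coeff_add]
  | monomial d c =>
    rw [MvPolynomial.aeval_monomial, MvPolynomial.coeff_monomial, algebraMap_eq, coeff_C_mul]
    by_cases hd : ∃ j, j ≠ i ∧ d j ≠ 0
    · obtain ⟨j, hj, hdj⟩ := hd
      rw [Finsupp.prod, Finset.prod_eq_zero (Finsupp.mem_support_iff.2 hdj) (by simp [hj, hdj]),
        coeff_zero, mul_zero, if_neg]
      rintro rfl
      simp [hj.symm] at hdj
    · push Not at hd
      have hsingle : d = Finsupp.single i (d i) := by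
        ext j
        by_cases hj : j = i
        · simp [hj]
        · simp [hd j hj, Ne.symm hj]
      rw [hsingle, Finsupp.prod_single_index (by simp), Pi.single_eq_same, coeff_X_pow]
      simp [(Finsupp.single_injective i).eq_iff, eq_comm]

/-- The resultant `Res_t(Q(t), P(t) - x)` in `R[x]`. Up to sign it is the restriction of
`implicitResultant P Q` to the axis `y = 0`, and that of `implicitResultant Q P` to `x = 0`. -/
noncomputable def axisResultant (P Q : R[X]) : R[X] :=
  resultant (Q.map C) (P.map C - C X) Q.natDegree P.natDegree

lemma coeff_single_zero_implicitResultant (k : ℕ) :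
    (implicitResultant P Q).coeff (Finsupp.single 0 k) ≠ 0 ↔ (axisResultant P Q).coeff k ≠ 0 := by
  rw [← coeff_aeval_single, map_implicitResultant, resultant_comm, MvPolynomial.aeval_X,
    MvPolynomial.aeval_X, Pi.single_eq_same, Pi.single_eq_of_ne one_ne_zero, C_0, sub_zero]
  rcases neg_one_pow_eq_or R[X] (P.natDegree * Q.natDegree) with h | h <;>
    simp [h, axisResultant, algebraMap_eq]

lemma coeff_single_one_implicitResultant (k : ℕ) :
    (implicitResultant P Q).coeff (Finsupp.single 1 k) = (axisResultant Q P).coeff k := by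
  rw [← coeff_aeval_single, map_implicitResultant, MvPolynomial.aeval_X, MvPolynomial.aeval_X,
    Pi.single_eq_same, Pi.single_eq_of_ne zero_ne_one, C_0, sub_zero]
  rfl

lemma coeff_zero_axisResultant : (axisResultant P Q).coeff 0 = resultant Q P := by
  have hmap := resultant_map_map (Q.map C) (P.map C - C X) Q.natDegree P.natDegree
    (evalRingHom (0 : R))
  have hC : (evalRingHom (0 : R)).comp C = RingHom.id R := by ext; simp
  rw [Polynomial.map_sub, Polynomial.map_map, Polynomial.map_map, hC, Polynomial.map_id,
    Polynomial.map_id, map_C, coe_evalRingHom, eval_X, C_0, sub_zero,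
    ← coeff_zero_eq_eval_zero] at hmap
  exact hmap.symm

lemma axisResultant_X_pow_mul (hQ : Q ≠ 0) (b : ℕ) :
    axisResultant P (X ^ b * Q) = (C (P.coeff 0) - X) ^ b * axisResultant P Q := by
  have : Nontrivial R := nontrivial_iff.1 (nontrivial_of_ne Q 0 hQ)
  have hdeg : (P.map C - C X).natDegree ≤ P.natDegree := natDegree_map_sub_C_le P X
  have hmul := resultant_mul_left (X ^ b) (Q.map C) (P.map C - C X) P.natDegree hdeg
  rw [natDegree_X_pow, natDegree_map_eq_of_injective C_injective,
    resultant_X_pow_left _ _ _ hdeg, coeff_sub, coeff_map, coeff_C_zero] at hmul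
  rw [axisResultant, mul_comm (X ^ b) Q, natDegree_mul_X_pow b hQ, mul_comm Q, add_comm,
    Polynomial.map_mul, Polynomial.map_pow, map_X, hmul, axisResultant]

lemma map_axisResultant {S : Type*} [CommRing S] {f : R →+* S} (hf : Function.Injective f)
    (P Q : R[X]) : (axisResultant P Q).map f = axisResultant (P.map f) (Q.map f) := by
  have hC : (mapRingHom f).comp C = C.comp f := by ext; simp
  have hmap := resultant_map_map (Q.map C) (P.map C - C X) Q.natDegree P.natDegree (mapRingHom f)
  rw [Polynomial.map_sub, Polynomial.map_map, Polynomial.map_map, hC, map_C, coe_mapRingHom,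
    map_X] at hmap
  rw [axisResultant, axisResultant, natDegree_map_eq_of_injective hf,
    natDegree_map_eq_of_injective hf, Polynomial.map_map, Polynomial.map_map, hmap]

end CommRing

lemma axisResultant_of_splits {R : Type*} [CommRing R] [IsDomain R] {P Q : R[X]}
    (hQ : Q.Splits) : axisResultant P Q =
      C (Q.leadingCoeff ^ P.natDegree) * (Q.roots.map fun s => C (P.eval s) - X).prod := by
  have hprod := resultant_eq_prod_eval (Q.map C) (P.map C - C X) P.natDegree
    (natDegree_map_sub_C_le P X) (hQ.map C)
  rw [natDegree_map_eq_of_injective C_injective, leadingCoeff_map_of_injective C_injective,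
    hQ.roots_map_of_injective C_injective, Multiset.map_map, ← C_pow] at hprod
  rw [axisResultant, hprod]
  simp [eval_map, eval₂_at_apply]

lemma coeff_natDegree_axisResultant_of_splits {R : Type*} [CommRing R] [IsDomain R] {P Q : R[X]}
    (hQ : Q.Splits) (hQ0 : Q ≠ 0) : (axisResultant P Q).coeff Q.natDegree ≠ 0 := by
  have hdeg (r : R) : (C r - X).natDegree = 1 := by rw [natDegree_sub, natDegree_X_sub_C]
  have hne : (0 : R[X]) ∉ Q.roots.map fun s => C (P.eval s) - X := by
    rw [Multiset.mem_map]
    rintro ⟨s, -, hs⟩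
    simpa [hs] using hdeg (P.eval s)
  have hprod : (Q.roots.map fun s => C (P.eval s) - X).prod.natDegree = Q.natDegree := by
    rw [natDegree_multiset_prod _ hne, Multiset.map_map, hQ.natDegree_eq_card_roots]
    simp [hdeg]
  rw [axisResultant_of_splits hQ, coeff_C_mul]
  refine mul_ne_zero (pow_ne_zero _ (leadingCoeff_ne_zero.2 hQ0)) ?_
  rw [← hprod]
  exact leadingCoeff_ne_zero.2 (Multiset.prod_ne_zero hne)

variable {K : Type*} [Field K] {P Q : K[X]}

lemma coeff_natDegree_axisResultant_ne_zero (hQ : Q ≠ 0) :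
    (axisResultant P Q).coeff Q.natDegree ≠ 0 := by
  have hinj := (algebraMap K (AlgebraicClosure K)).injective
  have hcoeff := coeff_natDegree_axisResultant_of_splits
    (P := P.map (algebraMap K (AlgebraicClosure K))) (IsAlgClosed.splits (Q.map _))
    ((Polynomial.map_ne_zero_iff hinj).2 hQ)
  rw [← map_axisResultant hinj, natDegree_map, coeff_map] at hcoeff
  exact (_root_.map_ne_zero _).1 hcoeff

lemma coeff_axisResultant_X_pow_mul_ne_zero {b : ℕ} (hQ : Q ≠ 0) (h : IsCoprime P Q)
    (hb : b = 0 ∨ P.coeff 0 = 0) : (axisResultant P (X ^ b * Q)).coeff b ≠ 0 := by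
  have h0 : (axisResultant P Q).coeff 0 ≠ 0 := by
    rw [coeff_zero_axisResultant]
    exact resultant_ne_zero Q P h.symm
  rw [axisResultant_X_pow_mul hQ]
  rcases hb with rfl | hP
  · rwa [pow_zero, one_mul]
  · rw [hP, C_0, zero_sub, neg_pow, mul_assoc, ← C_1, ← C_neg, ← C_pow, coeff_C_mul,
      coeff_X_pow_mul', if_pos le_rfl, Nat.sub_self]
    exact mul_ne_zero (pow_ne_zero _ (neg_ne_zero.2 one_ne_zero)) h0

end Axes

section Kernel

open IntermediateField

variable {K : Type*} [Field K] {P Q : K[X]}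

/-- The field `K(P, Q)` generated by the coordinates of the parameterization, inside `K(t)`. -/
noncomputable def parameterField (P Q : K[X]) : IntermediateField K (RatFunc K) :=
  adjoin K {algebraMap K[X] (RatFunc K) P, algebraMap K[X] (RatFunc K) Q}

lemma parameterField_comm (P Q : K[X]) : parameterField P Q = parameterField Q P := by
  rw [parameterField, parameterField, Set.pair_comm]

lemma natDegree_ne_zero_of_parameterField_eq_top (h : parameterField P Q = ⊤) :
    P.natDegree ≠ 0 ∨ Q.natDegree ≠ 0 := by
  by_contra! hconst
  obtain ⟨p, rfl⟩ := natDegree_eq_zero.1 hconst.1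
  obtain ⟨q, rfl⟩ := natDegree_eq_zero.1 hconst.2
  have hbot : (⊤ : IntermediateField K (RatFunc K)) ≤ ⊥ := by
    rw [← h, parameterField, adjoin_le_iff]
    rintro x (rfl | rfl)
    exacts [⟨p, by simp⟩, ⟨q, by simp⟩]
  obtain ⟨c, hc⟩ := mem_bot.1 (hbot (mem_top (x := (RatFunc.X : RatFunc K))))
  have hX : C c = (X : K[X]) := RatFunc.algebraMap_injective K (by
    rw [RatFunc.algebraMap_C, RatFunc.algebraMap_X, ← hc, RatFunc.algebraMap_eq_C])
  simpa using congrArg natDegree hX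

lemma natDegree_minpoly_of_parameterField_eq_top (hP : P.natDegree ≠ 0)
    (h : parameterField P Q = ⊤) :
    (minpoly K⟮algebraMap K[X] (RatFunc K) P⟯ (algebraMap K[X] (RatFunc K) Q)).natDegree =
      P.natDegree := by
  have hrank : Module.finrank K⟮algebraMap K[X] (RatFunc K) P⟯ (RatFunc K) = P.natDegree := by
    rw [RatFunc.finrank_eq_max_natDegree]
    simp
  have : FiniteDimensional K⟮algebraMap K[X] (RatFunc K) P⟯ (RatFunc K) :=
    .of_finrank_pos (hrank ▸ Nat.pos_of_ne_zero hP)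
  have htop : K⟮algebraMap K[X] (RatFunc K) P⟯⟮algebraMap K[X] (RatFunc K) Q⟯ = ⊤ := by
    rw [← restrictScalars_eq_top_iff (K := K), adjoin_simple_adjoin_simple]
    exact h
  rw [← adjoin.finrank (.of_finite _ _), htop, finrank_top', hrank]

lemma linearIndependent_pow_of_transcendental {R A : Type*} [CommRing R] [Ring A] [Algebra R A]
    {x : A} (hx : Transcendental R x) : LinearIndependent R fun k : ℕ => x ^ k := by
  have hker : LinearMap.ker (aeval (R := R) x).toLinearMap = ⊥ :=
    LinearMap.ker_eq_bot.2 (transcendental_iff_injective.1 hx)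
  simpa [Function.comp_def] using (basisMonomials R).linearIndependent.map' _ hker

lemma transcendental_gen_of_natDegree_ne_zero (hP : P.natDegree ≠ 0) :
    Transcendental K (AdjoinSimple.gen K (algebraMap K[X] (RatFunc K) P)) := by
  have htrans : Transcendental K (algebraMap K[X] (RatFunc K) P) := by
    refine RatFunc.transcendental_of_ne_C _ ?_
    rintro ⟨c, hc⟩
    have hPc : P = C c := RatFunc.algebraMap_injective K (by rw [RatFunc.algebraMap_C, hc])
    exact hP (by rw [hPc, natDegree_C])
  exact fun halg => htrans (by simpa using halg.algebraMap (A := RatFunc K))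

lemma linearIndependent_pow_mul_pow (hP : P.natDegree ≠ 0) (h : parameterField P Q = ⊤) :
    LinearIndependent K fun e : ℕ × Fin P.natDegree => P ^ e.1 * Q ^ (e.2 : ℕ) := by
  have hQ := linearIndependent_pow (K := K⟮algebraMap K[X] (RatFunc K) P⟯)
    (algebraMap K[X] (RatFunc K) Q)
  rw [natDegree_minpoly_of_parameterField_eq_top hP h] at hQ
  refine .of_comp (IsScalarTower.toAlgHom K K[X] (RatFunc K)).toLinearMap ?_
  convert! linearIndependent_smul
    (linearIndependent_pow_of_transcendental (transcendental_gen_of_natDegree_ne_zero hP)) hQ with e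
  simp [Algebra.smul_def]

lemma eq_zero_of_aeval_eq_zero {p : Fin 2 → K[X]} {i j : Fin 2} (hij : i ≠ j)
    (hp : (p i).natDegree ≠ 0) (h : parameterField (p i) (p j) = ⊤)
    {r : MvPolynomial (Fin 2) K} (hr : ∀ d ∈ r.support, d j < (p i).natDegree)
    (h0 : MvPolynomial.aeval p r = 0) : r = 0 := by
  have hfin (k : Fin 2) : k = i ∨ k = j := by omega
  let exponents (d : r.support) : ℕ × Fin (p i).natDegree := (d.1 i, ⟨d.1 j, hr d d.2⟩)
  have hinj : Function.Injective exponents := by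
    rintro ⟨d, hd⟩ ⟨e, he⟩ hde
    obtain ⟨hi, hj⟩ := Prod.mk.inj hde
    refine Subtype.ext (Finsupp.ext fun k => ?_)
    rcases hfin k with rfl | rfl
    exacts [hi, Fin.mk.inj hj]
  have hind := Fintype.linearIndependent_iff.1
    ((linearIndependent_pow_mul_pow hp h).comp exponents hinj) (fun d => r.coeff d) (by
      rw [MvPolynomial.aeval_def, MvPolynomial.eval₂_eq', ← Finset.sum_coe_sort] at h0
      rw [← h0]
      refine Finset.sum_congr rfl fun d _ => ?_
      rw [show (Finset.univ : Finset (Fin 2)) = {i, j} by ext k; simpa using hfin k,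
        Finset.prod_pair hij, smul_eq_C_mul]
      rfl)
  ext d
  by_contra hd
  exact hd (hind ⟨d, MvPolynomial.mem_support_iff.2 hd⟩)

-- Division by `φ` leaves a remainder of degree less than `deg (p i)` in the variable `j`.
lemma ker_aeval_eq_span_singleton {p : Fin 2 → K[X]} {i j : Fin 2} (hij : i ≠ j)
    (hp : (p i).natDegree ≠ 0) (h : parameterField (p i) (p j) = ⊤)
    (m : MonomialOrder (Fin 2)) {φ : MvPolynomial (Fin 2) K} (h0 : MvPolynomial.aeval p φ = 0)
    (hφ : φ ≠ 0) (hdeg : m.degree φ = Finsupp.single j (p i).natDegree) :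
    RingHom.ker (MvPolynomial.aeval (R := K) p) = Ideal.span {φ} := by
  refine le_antisymm (fun ψ hψ => ?_) ((Ideal.span_singleton_le_iff_mem _).2 h0)
  obtain ⟨g, r, hψr, -, hr⟩ := m.div_single (m.leadingCoeff_ne_zero_iff.2 hφ).isUnit ψ
  have hr0 : r = 0 := by
    refine eq_zero_of_aeval_eq_zero hij hp h (fun d hd => ?_) ?_
    · exact not_le.1 fun hle => hr d hd (hdeg ▸ Finsupp.single_le_iff.2 hle)
    · rw [RingHom.mem_ker, hψr, map_add, map_mul, h0, mul_zero, zero_add] at hψ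
      exact hψ
  rw [hψr, hr0, add_zero]
  exact Ideal.mem_span_singleton.2 (dvd_mul_left φ g)

end Kernel

section ImplicitEquation

variable {K : Type*} [Field K] {P Q : K[X]}

lemma degree_lex_eq {σ R : Type*} [LinearOrder σ] [WellFoundedGT σ] [CommSemiring R]
    {φ : MvPolynomial σ R} {e : σ →₀ ℕ} (he : φ.coeff e ≠ 0)
    (hle : ∀ d ∈ φ.support, ∀ k, (∀ l < k, e l = d l) → d k ≤ e k) :
    MonomialOrder.lex.degree φ = e := by
  refine MonomialOrder.lex.toSyn.injective (le_antisymm (MonomialOrder.degree_le_iff.2 ?_)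
    (MonomialOrder.le_degree (MvPolynomial.mem_support_iff.2 he)))
  intro d hd
  refine not_lt.1 fun hlt => ?_
  obtain ⟨k, hk, hlt⟩ := MonomialOrder.lex_lt_iff.1 hlt
  exact not_lt.2 (hle d hd k hk) hlt

lemma ker_aeval_eq_span_implicitResultant (h : parameterField P Q = ⊤) :
    RingHom.ker (MvPolynomial.aeval (R := K) ![P, Q]) = Ideal.span {implicitResultant P Q} := by
  have hdeg := natDegree_ne_zero_of_parameterField_eq_top h
  have h0 := aeval_implicitResultant hdeg
  by_cases hQ : Q.natDegree = 0
  · have hP : P.natDegree ≠ 0 := hdeg.resolve_right (not_not.2 hQ)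
    have hc : (implicitResultant P Q).coeff (Finsupp.single 1 P.natDegree) ≠ 0 := by
      rw [coeff_single_one_implicitResultant]
      exact coeff_natDegree_axisResultant_ne_zero (ne_zero_of_natDegree_gt hP.bot_lt)
    refine ker_aeval_eq_span_singleton (p := ![P, Q]) (i := 0) (j := 1) zero_ne_one hP h .lex h0
      (MvPolynomial.ne_zero_iff.2 ⟨_, hc⟩) (degree_lex_eq hc fun d hd k _ => ?_)
    have hx := fst_le_natDegree_of_mem_support hd
    have hy := snd_le_natDegree_of_mem_support hd
    fin_cases k <;> simp_all
  · have hc : (implicitResultant P Q).coeff (Finsupp.single 0 Q.natDegree) ≠ 0 := by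
      rw [coeff_single_zero_implicitResultant]
      exact coeff_natDegree_axisResultant_ne_zero (ne_zero_of_natDegree_gt (pos_of_ne_zero hQ))
    refine ker_aeval_eq_span_singleton (p := ![P, Q]) (i := 1) (j := 0) one_ne_zero hQ
      (parameterField_comm P Q ▸ h) .lex h0
      (MvPolynomial.ne_zero_iff.2 ⟨_, hc⟩) (degree_lex_eq hc fun d hd k hk => ?_)
    fin_cases k
    · simpa using fst_le_natDegree_of_mem_support hd
    · have hx : Q.natDegree = d 0 := by simpa using hk 0 (by simp)
      have hw := weight_le_mul_of_mem_support hd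
      rw [← hx, add_le_iff_nonpos_right, nonpos_iff_eq_zero] at hw
      simpa [hQ] using hw

lemma support_eq_of_span_singleton_eq {R σ : Type*} [CommRing R] [IsDomain R]
    {φ ψ : MvPolynomial σ R} (h : Ideal.span {φ} = Ideal.span {ψ}) : φ.support = ψ.support := by
  obtain ⟨u, rfl⟩ := Ideal.span_singleton_eq_span_singleton.1 h
  obtain ⟨c, hc, hu⟩ := MvPolynomial.isUnit_iff_eq_C_of_isReduced.1 u.isUnit
  rw [hu, mul_comm, ← MvPolynomial.smul_eq_C_mul, MvPolynomial.support_smul_eq hc.ne_zero]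

end ImplicitEquation

section Quadrilateral

/-- The vertices of the region between the chords joining `(b, 0)` to `(0, a)` and `(m, 0)` to
`(0, n)`. It is a triangle when `a = b = 0`. -/
def chordVertices {𝕜 : Type*} [Zero 𝕜] (b m n a : 𝕜) : Set (𝕜 × 𝕜) :=
  {(b, 0), (m, 0), (0, n), (0, a)}

lemma chordVertices_zero_zero {𝕜 : Type*} [Zero 𝕜] (m n : 𝕜) :
    chordVertices 0 m n 0 = {(0, 0), (m, 0), (0, n)} := by
  ext
  simp only [chordVertices, Set.mem_insert_iff, Set.mem_singleton_iff]
  tauto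

variable {𝕜 : Type*} [Field 𝕜] [LinearOrder 𝕜] [IsStrictOrderedRing 𝕜]

lemma extremePoints_convexHull_eq_of_forall_lt {E : Type*} [AddCommGroup E] [Module 𝕜 E]
    {V : Set E} (hV : ∀ v ∈ V, ∃ l : E →ₗ[𝕜] 𝕜, ∀ u ∈ V, u ≠ v → l u < l v) :
    (convexHull 𝕜 V).extremePoints 𝕜 = V := by
  refine Set.Subset.antisymm extremePoints_convexHull_subset fun v hv => ?_
  obtain ⟨l, hl⟩ := hV v hv
  have hconv : Convex 𝕜 {u | u = v ∨ l u < l v} := by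
    refine convex_iff_pairwise_pos.2 fun x hx y hy hxy s t hs ht hst => .inr ?_
    have hv : l v = s * l v + t * l v := by rw [← add_mul, hst, one_mul]
    rw [map_add, map_smul, map_smul, smul_eq_mul, smul_eq_mul, hv]
    rcases hx with rfl | hx
    · exact add_lt_add_right (mul_lt_mul_of_pos_left (hy.resolve_left hxy.symm) ht) _
    · refine add_lt_add_of_lt_of_le (mul_lt_mul_of_pos_left hx hs) ?_
      rcases hy with rfl | hy
      exacts [le_rfl, (mul_lt_mul_of_pos_left hy ht).le]
  have hhull : convexHull 𝕜 V ⊆ {u | u = v ∨ l u < l v} :=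
    convexHull_min (fun u hu => or_iff_not_imp_left.2 (hl u hu)) hconv
  refine ((convex_convexHull 𝕜 V).mem_extremePoints_iff_mem_sdiff_convexHull_sdiff).2
    ⟨subset_convexHull 𝕜 V hv, fun hmem => ?_⟩
  have hlt : v ∈ {u | l u < l v} :=
    convexHull_min (fun u hu => (hhull hu.1).resolve_left hu.2)
      (convex_halfSpace_lt l.isLinear _) hmem
  exact lt_irrefl _ hlt

variable {a b m n : 𝕜}

lemma extremePoints_convexHull_chordVertices (ha : 0 ≤ a) (han : a ≤ n) (hb : 0 ≤ b)
    (hbm : b ≤ m) (hab : a = 0 ↔ b = 0) :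
    (convexHull 𝕜 (chordVertices b m n a)).extremePoints 𝕜 = chordVertices b m n a := by
  refine extremePoints_convexHull_eq_of_forall_lt fun v hv => ?_
  suffices ∃ α β : 𝕜, ∀ u ∈ chordVertices b m n a, u ≠ v →
      α * u.1 + β * u.2 < α * v.1 + β * v.2 by
    obtain ⟨α, β, h⟩ := this
    exact ⟨α • LinearMap.fst 𝕜 𝕜 𝕜 + β • LinearMap.snd 𝕜 𝕜 𝕜, h⟩
  by_cases h0 : v = 0
  · subst h0
    refine ⟨-1, -1, ?_⟩
    rintro u (rfl | rfl | rfl | rfl) hne <;>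
      simp only [ne_eq, Prod.mk_eq_zero, and_true, true_and, Prod.fst_zero, Prod.snd_zero] at hne ⊢
    exacts [by linarith [hb.lt_of_ne' hne], by linarith [(hb.trans hbm).lt_of_ne' hne],
      by linarith [(ha.trans han).lt_of_ne' hne], by linarith [ha.lt_of_ne' hne]]
  rcases hv with rfl | rfl | rfl | rfl
  · have hb' : 0 < b := hb.lt_of_ne' fun h => h0 (by rw [h]; rfl)
    have ha' : 0 < a := ha.lt_of_ne' (mt hab.1 hb'.ne')
    refine ⟨-a, -2 * b, ?_⟩
    rintro u (rfl | rfl | rfl | rfl) hne <;>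
      simp only [ne_eq, Prod.mk.injEq, and_true, not_true_eq_false] at hne ⊢
    exacts [by nlinarith [hbm.lt_of_ne' hne], by nlinarith, by nlinarith]
  · have hm : 0 < m := (hb.trans hbm).lt_of_ne' fun h => h0 (by rw [h]; rfl)
    refine ⟨1, 0, ?_⟩
    rintro u (rfl | rfl | rfl | rfl) hne <;>
      simp only [ne_eq, Prod.mk.injEq, and_true, not_true_eq_false] at hne ⊢
    exacts [by linarith [hbm.lt_of_ne hne], by linarith, by linarith]
  · have hn : 0 < n := (ha.trans han).lt_of_ne' fun h => h0 (by rw [h]; rfl)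
    refine ⟨0, 1, ?_⟩
    rintro u (rfl | rfl | rfl | rfl) hne <;>
      simp only [ne_eq, Prod.mk.injEq, true_and, not_true_eq_false] at hne ⊢
    exacts [by linarith, by linarith, by linarith [han.lt_of_ne hne]]
  · have ha' : 0 < a := ha.lt_of_ne' fun h => h0 (by rw [h]; rfl)
    have hb' : 0 < b := hb.lt_of_ne' (mt hab.2 ha'.ne')
    refine ⟨-2 * a, -b, ?_⟩
    rintro u (rfl | rfl | rfl | rfl) hne <;>
      simp only [ne_eq, Prod.mk.injEq, true_and, not_true_eq_false] at hne ⊢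
    exacts [by nlinarith, by nlinarith, by nlinarith [han.lt_of_ne' hne]]

lemma mk_mem_segment_axes {p q y : 𝕜} (hq : 0 < q) (hy : 0 ≤ y) (hyq : y ≤ q) :
    ((1 - y / q) * p, y) ∈ segment 𝕜 ((p, 0) : 𝕜 × 𝕜) (0, q) :=
  ⟨1 - y / q, y / q, sub_nonneg.2 ((div_le_one hq).2 hyq), div_nonneg hy hq.le,
    sub_add_cancel _ _, by simp [hq.ne']⟩

-- Sweep the region by horizontal lines: `(x, y)` lies between two boundary points of height `y`.
lemma mem_convexHull_chordVertices {x y : 𝕜} (hx : 0 ≤ x) (hxm : x ≤ m) (hy : 0 ≤ y)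
    (hyn : y ≤ n) (hupper : n * x + m * y ≤ n * m) (hlower : a * b ≤ a * x + b * y) :
    (x, y) ∈ convexHull 𝕜 (chordVertices b m n a) := by
  have hsegment {u v w : 𝕜 × 𝕜} (hu : u ∈ chordVertices b m n a)
      (hv : v ∈ chordVertices b m n a) (hw : w ∈ segment 𝕜 u v) :
      w ∈ convexHull 𝕜 (chordVertices b m n a) := segment_subset_convexHull hu hv hw
  obtain ⟨x₁, hx₁, hleft⟩ : ∃ x₁ ≤ x, (x₁, y) ∈ convexHull 𝕜 (chordVertices b m n a) := by
    rcases le_or_gt a y with hay | hya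
    · refine ⟨0, hx, hsegment (u := (0, a)) (v := (0, n)) (by simp [chordVertices])
        (by simp [chordVertices]) ?_⟩
      rw [← Prod.image_mk_segment_right, segment_eq_Icc (hay.trans hyn)]
      exact ⟨y, ⟨hay, hyn⟩, rfl⟩
    · have ha' : 0 < a := hy.trans_lt hya
      refine ⟨_, ?_, hsegment (.inl rfl) (by simp [chordVertices])
        (mk_mem_segment_axes ha' hy hya.le)⟩
      rw [← mul_le_mul_iff_right₀ ha']
      field_simp
      linarith
  obtain ⟨x₂, hx₂, hright⟩ : ∃ x₂, x ≤ x₂ ∧ (x₂, y) ∈ convexHull 𝕜 (chordVertices b m n a) := by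
    rcases hy.eq_or_lt with rfl | hy'
    · exact ⟨m, hxm, subset_convexHull 𝕜 _ (.inr (.inl rfl))⟩
    · have hn : 0 < n := hy'.trans_le hyn
      refine ⟨_, ?_, hsegment (.inr (.inl rfl)) (by simp [chordVertices])
        (mk_mem_segment_axes hn hy hyn)⟩
      rw [← mul_le_mul_iff_right₀ hn]
      field_simp
      linarith
  have hbetween : (x, y) ∈ segment 𝕜 (x₁, y) (x₂, y) := by
    rw [← Prod.image_mk_segment_left, segment_eq_Icc (hx₁.trans hx₂)]
    exact ⟨x, ⟨hx₁, hx₂⟩, rfl⟩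
  exact (convex_convexHull 𝕜 _).segment_subset hleft hright hbetween

end Quadrilateral
section RelationPolygon

variable {K : Type*} [Field K] {P Q : K[X]}

/-- The Newton polygon of a polynomial in two variables over an arbitrary field, drawn in `ℝ²`. -/
def exponentPolygon (φ : MvPolynomial (Fin 2) K) : Set (ℝ × ℝ) :=
  convexHull ℝ ((fun d : Fin 2 →₀ ℕ => ((d 0 : ℝ), (d 1 : ℝ))) '' (φ.support : Set (Fin 2 →₀ ℕ)))

/-- The ideal of algebraic relations between `P` and `Q` is principal, and `V` is the vertex set of
the Newton polygon of each of its generators. For `K = ℂ` this is `ImplicitPolygonHasVertices`. -/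
def RelationPolygonHasVertices (P Q : K[X]) (V : Set (ℝ × ℝ)) : Prop :=
  (∃ φ, RingHom.ker (MvPolynomial.aeval (R := K) ![P, Q]) = Ideal.span {φ}) ∧
    ∀ φ, RingHom.ker (MvPolynomial.aeval (R := K) ![P, Q]) = Ideal.span {φ} →
      exponentPolygon φ = convexHull ℝ V ∧ (exponentPolygon φ).extremePoints ℝ = V

lemma relationPolygonHasVertices_of_ker_eq {φ : MvPolynomial (Fin 2) K} {V : Set (ℝ × ℝ)}
    (hφ : RingHom.ker (MvPolynomial.aeval (R := K) ![P, Q]) = Ideal.span {φ})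
    (hpolygon : exponentPolygon φ = convexHull ℝ V)
    (hvertices : (convexHull ℝ V).extremePoints ℝ = V) : RelationPolygonHasVertices P Q V := by
  refine ⟨⟨φ, hφ⟩, fun ψ hψ => ?_⟩
  have hψφ : exponentPolygon ψ = convexHull ℝ V := by
    rw [← hpolygon, exponentPolygon, support_eq_of_span_singleton_eq (hψ.symm.trans hφ)]
    rfl
  exact ⟨hψφ, hψφ ▸ hvertices⟩

variable {a b : ℕ}

lemma exponentPolygon_implicitResultant_X_pow_mul (hP : P ≠ 0) (hQ : Q ≠ 0)
    (hPQ : IsCoprime (X ^ a * P) Q) (hQP : IsCoprime (X ^ b * Q) P) (hab : a = 0 ↔ b = 0) :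
    exponentPolygon (implicitResultant (X ^ a * P) (X ^ b * Q)) =
      convexHull ℝ (chordVertices (b : ℝ) (X ^ b * Q).natDegree (X ^ a * P).natDegree a) := by
  have hXP : X ^ a * P ≠ 0 := mul_ne_zero (pow_ne_zero a X_ne_zero) hP
  have hXQ : X ^ b * Q ≠ 0 := mul_ne_zero (pow_ne_zero b X_ne_zero) hQ
  have hcoeff {k : ℕ} {F : K[X]} (hk : k ≠ 0) : (X ^ k * F).coeff 0 = 0 := by
    rw [mul_coeff_zero, coeff_X_pow, if_neg hk.symm, zero_mul]
  have hb := coeff_axisResultant_X_pow_mul_ne_zero hQ hPQ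
    (or_iff_not_imp_left.2 fun hb => hcoeff (mt hab.1 hb))
  have ha := coeff_axisResultant_X_pow_mul_ne_zero hP hQP
    (or_iff_not_imp_left.2 fun ha => hcoeff (mt hab.2 ha))
  have han : a ≤ (X ^ a * P).natDegree := natDegree_X_pow_mul a hP ▸ Nat.le_add_left a _
  have hbm : b ≤ (X ^ b * Q).natDegree := natDegree_X_pow_mul b hQ ▸ Nat.le_add_left b _
  refine Set.Subset.antisymm (convexHull_min ?_ (convex_convexHull ℝ _)) (convexHull_mono ?_)
  · rintro _ ⟨d, hd, rfl⟩
    refine mem_convexHull_chordVertices (Nat.cast_nonneg _)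
      (Nat.cast_le.2 (fst_le_natDegree_of_mem_support hd)) (Nat.cast_nonneg _)
      (Nat.cast_le.2 (snd_le_natDegree_of_mem_support hd)) ?_ ?_
    · exact_mod_cast weight_le_mul_of_mem_support hd
    · exact_mod_cast mul_le_weight_of_mem_support han hbm (dvd_mul_right _ _) (dvd_mul_right _ _) hd
  · rintro _ (rfl | rfl | rfl | rfl)
    · exact ⟨.single 0 b, MvPolynomial.mem_support_iff.2
        ((coeff_single_zero_implicitResultant _).2 hb), by simp⟩
    · exact ⟨.single 0 _, MvPolynomial.mem_support_iff.2
        ((coeff_single_zero_implicitResultant _).2 (coeff_natDegree_axisResultant_ne_zero hXQ)),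
        by simp⟩
    · exact ⟨.single 1 _, MvPolynomial.mem_support_iff.2
        ((coeff_single_one_implicitResultant _).trans_ne
          (coeff_natDegree_axisResultant_ne_zero hXP)), by simp⟩
    · exact ⟨.single 1 a, MvPolynomial.mem_support_iff.2
        ((coeff_single_one_implicitResultant _).trans_ne ha), by simp⟩

lemma relationPolygonHasVertices_chordVertices (hP : P ≠ 0) (hQ : Q ≠ 0)
    (hPQ : IsCoprime (X ^ a * P) Q) (hQP : IsCoprime (X ^ b * Q) P) (hab : a = 0 ↔ b = 0)
    (h : parameterField (X ^ a * P) (X ^ b * Q) = ⊤) :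
    RelationPolygonHasVertices (X ^ a * P) (X ^ b * Q)
      (chordVertices (b : ℝ) (X ^ b * Q).natDegree (X ^ a * P).natDegree a) :=
  relationPolygonHasVertices_of_ker_eq (ker_aeval_eq_span_implicitResultant h)
    (exponentPolygon_implicitResultant_X_pow_mul hP hQ hPQ hQP hab)
    (extremePoints_convexHull_chordVertices (Nat.cast_nonneg a)
      (Nat.cast_le.2 (natDegree_X_pow_mul a hP ▸ Nat.le_add_left a _)) (Nat.cast_nonneg b)
      (Nat.cast_le.2 (natDegree_X_pow_mul b hQ ▸ Nat.le_add_left b _))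
      (by rw [Nat.cast_eq_zero, Nat.cast_eq_zero, hab]))

end RelationPolygon

section SparsePolynomial

lemma injective_sub_of_forall_le {ι : Type*} {e : ι → ℕ} {a : ℕ} (he : Function.Injective e)
    (ha : ∀ k, a ≤ e k) : Function.Injective fun k => e k - a := fun j k hjk =>
  he ((tsub_left_inj (ha j) (ha k)).1 hjk)

/-- The polynomial with exponents `e k` and coefficients `c k`; for `e` the inclusion of a finite
set `S` of exponents this is `polyOf S c`, over any semiring. -/
noncomputable def sparsePolynomial {ι R : Type*} [Fintype ι] [Semiring R] (e : ι → ℕ) (c : ι → R) :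
    R[X] :=
  ∑ k, monomial (e k) (c k)

section Semiring

variable {ι R : Type*} [Fintype ι] [Semiring R] {e : ι → ℕ} {c : ι → R} {i : ι}

lemma map_sparsePolynomial {S : Type*} [Semiring S] (f : R →+* S) (e : ι → ℕ) (c : ι → R) :
    (sparsePolynomial e c).map f = sparsePolynomial e fun k => f (c k) := by
  simp [sparsePolynomial, Polynomial.map_sum]

lemma X_pow_mul_sparsePolynomial_sub {a : ℕ} (ha : ∀ k, a ≤ e k) :
    X ^ a * sparsePolynomial (fun k => e k - a) c = sparsePolynomial e c := by
  simp [sparsePolynomial, Finset.mul_sum, X_pow_mul_monomial, ha]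

lemma sparsePolynomial_single [DecidableEq ι] (e : ι → ℕ) (i : ι) :
    sparsePolynomial e (Pi.single i (1 : R)) = X ^ e i := by
  simp [sparsePolynomial, Pi.single_apply, apply_ite, monomial_one_right_eq_X_pow]

lemma coeff_sparsePolynomial (he : Function.Injective e) (c : ι → R) (i : ι) :
    (sparsePolynomial e c).coeff (e i) = c i := by
  classical
  simp [sparsePolynomial, coeff_monomial, he.eq_iff]

lemma sparsePolynomial_ne_zero (he : Function.Injective e) (hc : c i ≠ 0) :
    sparsePolynomial e c ≠ 0 := fun h =>
  hc (by rw [← coeff_sparsePolynomial he c i, h, coeff_zero])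

lemma natDegree_sparsePolynomial (he : Function.Injective e) (hi : ∀ k, e k ≤ e i)
    (hc : c i ≠ 0) : (sparsePolynomial e c).natDegree = e i :=
  le_antisymm
    (natDegree_sum_le_of_forall_le _ _ fun k _ => (natDegree_monomial_le _).trans (hi k))
    (le_natDegree_of_ne_zero ((coeff_sparsePolynomial he c i).trans_ne hc))

lemma coeff_zero_sparsePolynomial_sub_ne_zero {a : ℕ} (he : Function.Injective e)
    (ha : ∀ k, a ≤ e k) (hmin : ∃ k, e k = a) (hc : ∀ k, c k ≠ 0) :
    (sparsePolynomial (fun k => e k - a) c).coeff 0 ≠ 0 := by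
  obtain ⟨k, rfl⟩ := hmin
  have hcoeff := coeff_sparsePolynomial (injective_sub_of_forall_le he ha) c k
  rw [tsub_self] at hcoeff
  exact hcoeff.trans_ne (hc k)

end Semiring

section Generic

lemma isCoprime_X_pow_mul_left {K : Type*} [Field K] {P Q : K[X]} {a : ℕ} (h : IsCoprime P Q)
    (ha : a ≠ 0 → Q.coeff 0 ≠ 0) : IsCoprime (X ^ a * P) Q := by
  refine .mul_left ?_ h
  by_cases h0 : a = 0
  · rw [h0, pow_zero]
    exact isCoprime_one_left
  · exact .pow_left (irreducible_X.coprime_iff_not_dvd.2 (mt X_dvd_iff.1 (ha h0)))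

variable {ι₀ ι₁ : Type*} [Fintype ι₀] [Fintype ι₁] {e₀ : ι₀ → ℕ} {e₁ : ι₁ → ℕ} {i₀ : ι₀} {i₁ : ι₁}

/-- The resultant, in degrees `n` and `m`, of the polynomials with exponents `e₀` and `e₁` and
indeterminate coefficients. -/
noncomputable def sparseResultant (R : Type*) [CommRing R] (e₀ : ι₀ → ℕ) (e₁ : ι₁ → ℕ) (n m : ℕ) :
    MvPolynomial (ι₀ ⊕ ι₁) R :=
  resultant (sparsePolynomial e₀ fun k => MvPolynomial.X (.inl k))
    (sparsePolynomial e₁ fun k => MvPolynomial.X (.inr k)) n m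

section CommRing

variable {R : Type*} [CommRing R]

lemma eval_sparseResultant (c : ι₀ ⊕ ι₁ → R) (n m : ℕ) :
    MvPolynomial.eval c (sparseResultant R e₀ e₁ n m) =
      resultant (sparsePolynomial e₀ (c ∘ Sum.inl)) (sparsePolynomial e₁ (c ∘ Sum.inr)) n m := by
  rw [sparseResultant, ← resultant_map_map, map_sparsePolynomial, map_sparsePolynomial]
  congr 2 <;> funext k <;> exact MvPolynomial.eval_X _

-- Specialise one polynomial to `1` and the other to its top monomial.
lemma sparseResultant_ne_zero [Nontrivial R] (i₀ : ι₀) (i₁ : ι₁)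
    (h : (∃ i, e₀ i = 0) ∨ ∃ i, e₁ i = 0) :
    sparseResultant R e₀ e₁ (e₀ i₀) (e₁ i₁) ≠ 0 := by
  classical
  suffices ∃ c, MvPolynomial.eval c (sparseResultant R e₀ e₁ (e₀ i₀) (e₁ i₁)) ≠ 0 by
    obtain ⟨c, hc⟩ := this
    exact fun h => hc (by rw [h, map_zero])
  rcases h with ⟨i, hi⟩ | ⟨i, hi⟩
  · refine ⟨Sum.elim (Pi.single i 1) (Pi.single i₁ 1), ?_⟩
    rw [eval_sparseResultant, Sum.elim_comp_inl, Sum.elim_comp_inr, sparsePolynomial_single,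
      sparsePolynomial_single, hi, pow_zero, resultant_one_left, coeff_X_pow_self, one_pow, mul_one]
    exact (isUnit_one.neg.pow _).ne_zero
  · refine ⟨Sum.elim (Pi.single i₀ 1) (Pi.single i 1), ?_⟩
    rw [eval_sparseResultant, Sum.elim_comp_inl, Sum.elim_comp_inr, sparsePolynomial_single,
      sparsePolynomial_single, hi, pow_zero, resultant_one_right, coeff_X_pow_self, one_pow]
    exact one_ne_zero

end CommRing

variable {K : Type*} [Field K]

lemma isCoprime_sparsePolynomial {c₀ : ι₀ → K} {c₁ : ι₁ → K} (he₀ : Function.Injective e₀)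
    (he₁ : Function.Injective e₁) (hi₀ : ∀ k, e₀ k ≤ e₀ i₀) (hi₁ : ∀ k, e₁ k ≤ e₁ i₁)
    (hc₀ : c₀ i₀ ≠ 0) (hc₁ : c₁ i₁ ≠ 0)
    (h : resultant (sparsePolynomial e₀ c₀) (sparsePolynomial e₁ c₁) (e₀ i₀) (e₁ i₁) ≠ 0) :
    IsCoprime (sparsePolynomial e₀ c₀) (sparsePolynomial e₁ c₁) := by
  rw [← natDegree_sparsePolynomial he₀ hi₀ hc₀, ← natDegree_sparsePolynomial he₁ hi₁ hc₁] at h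
  by_contra hcoprime
  exact h (resultant_eq_zero_iff.2 ⟨.inl (sparsePolynomial_ne_zero he₀ hc₀), hcoprime⟩)

lemma exists_forall_isCoprime_sparsePolynomial (he₀ : Function.Injective e₀)
    (he₁ : Function.Injective e₁) (hi₀ : ∀ k, e₀ k ≤ e₀ i₀) (hi₁ : ∀ k, e₁ k ≤ e₁ i₁)
    (h : (∃ i, e₀ i = 0) ∨ ∃ i, e₁ i = 0) :
    ∃ F : MvPolynomial (ι₀ ⊕ ι₁) K, F ≠ 0 ∧ ∀ c, MvPolynomial.eval c F ≠ 0 → (∀ i, c i ≠ 0) ∧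
      IsCoprime (sparsePolynomial e₀ (c ∘ Sum.inl)) (sparsePolynomial e₁ (c ∘ Sum.inr)) := by
  refine ⟨(∏ i, MvPolynomial.X i) * sparseResultant K e₀ e₁ (e₀ i₀) (e₁ i₁),
    mul_ne_zero (Finset.prod_ne_zero_iff.2 fun i _ => MvPolynomial.X_ne_zero i)
      (sparseResultant_ne_zero i₀ i₁ h), fun c hc => ?_⟩
  simp only [map_mul, map_prod, MvPolynomial.eval_X, eval_sparseResultant, mul_ne_zero_iff,
    Finset.prod_ne_zero_iff, Finset.mem_univ, true_implies] at hc
  exact ⟨hc.1, isCoprime_sparsePolynomial he₀ he₁ hi₀ hi₁ (hc.1 _) (hc.1 _) hc.2⟩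

lemma exists_forall_relationPolygonHasVertices {a b : ℕ} (he₀ : Function.Injective e₀)
    (he₁ : Function.Injective e₁) (hi₀ : ∀ k, e₀ k ≤ e₀ i₀) (hi₁ : ∀ k, e₁ k ≤ e₁ i₁)
    (ha : ∀ k, a ≤ e₀ k) (hb : ∀ k, b ≤ e₁ k) (hab : a = 0 ↔ b = 0)
    (hmin : (∃ i, e₀ i = a) ∨ ∃ i, e₁ i = b)
    (hmin' : a ≠ 0 → (∃ i, e₀ i = a) ∧ ∃ i, e₁ i = b) :
    ∃ F : MvPolynomial (ι₀ ⊕ ι₁) K, F ≠ 0 ∧ ∀ c, MvPolynomial.eval c F ≠ 0 →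
      parameterField (sparsePolynomial e₀ (c ∘ Sum.inl)) (sparsePolynomial e₁ (c ∘ Sum.inr)) = ⊤ →
      RelationPolygonHasVertices (sparsePolynomial e₀ (c ∘ Sum.inl))
        (sparsePolynomial e₁ (c ∘ Sum.inr)) (chordVertices (b : ℝ) (e₁ i₁) (e₀ i₀) a) := by
  have hinj₀ := injective_sub_of_forall_le he₀ ha
  have hinj₁ := injective_sub_of_forall_le he₁ hb
  obtain ⟨F, hF, hcoprime⟩ := exists_forall_isCoprime_sparsePolynomial (K := K) hinj₀ hinj₁
    (fun k => tsub_le_tsub_right (hi₀ k) a) (fun k => tsub_le_tsub_right (hi₁ k) b)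
    (hmin.imp (fun ⟨i, hi⟩ => ⟨i, by rw [hi, tsub_self]⟩) fun ⟨i, hi⟩ => ⟨i, by rw [hi, tsub_self]⟩)
  refine ⟨F, hF, fun c hc htop => ?_⟩
  obtain ⟨hc, hcoprime⟩ := hcoprime c hc
  rw [← natDegree_sparsePolynomial (c := c ∘ Sum.inl) he₀ hi₀ (hc _),
    ← natDegree_sparsePolynomial (c := c ∘ Sum.inr) he₁ hi₁ (hc _)]
  rw [← X_pow_mul_sparsePolynomial_sub ha, ← X_pow_mul_sparsePolynomial_sub hb] at htop ⊢
  exact relationPolygonHasVertices_chordVertices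
    (sparsePolynomial_ne_zero (i := i₀) hinj₀ (hc _))
    (sparsePolynomial_ne_zero (i := i₁) hinj₁ (hc _))
    (isCoprime_X_pow_mul_left hcoprime fun h =>
      coeff_zero_sparsePolynomial_sub_ne_zero he₁ hb (hmin' h).2 fun _ => hc _)
    (isCoprime_X_pow_mul_left hcoprime.symm fun h =>
      coeff_zero_sparsePolynomial_sub_ne_zero he₀ ha (hmin' (mt hab.1 h)).1 fun _ => hc _) hab htop

end Generic

end SparsePolynomial

theorem theoremT_general {K : Type*} [Field K] (S₀ S₁ : Finset ℕ) (h₀ : S₀.Nonempty)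
    (h₁ : S₁.Nonempty) :
    ((0 ∈ S₀ ∨ 0 ∈ S₁) →
      ∃ F : MvPolynomial (S₀ ⊕ S₁) K, F ≠ 0 ∧ ∀ c, MvPolynomial.eval c F ≠ 0 →
        Module.finrank (parameterField (sparsePolynomial ((↑) : S₀ → ℕ) (c ∘ Sum.inl))
            (sparsePolynomial ((↑) : S₁ → ℕ) (c ∘ Sum.inr))) (RatFunc K) = 1 →
          RelationPolygonHasVertices
            (sparsePolynomial ((↑) : S₀ → ℕ) (c ∘ Sum.inl))
            (sparsePolynomial ((↑) : S₁ → ℕ) (c ∘ Sum.inr))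
            {((0 : ℝ), (0 : ℝ)), ((S₁.max' h₁ : ℝ), (0 : ℝ)), ((0 : ℝ), (S₀.max' h₀ : ℝ))}) ∧
    (0 ∉ S₀ → 0 ∉ S₁ →
      ∃ F : MvPolynomial (S₀ ⊕ S₁) K, F ≠ 0 ∧ ∀ c, MvPolynomial.eval c F ≠ 0 →
        Module.finrank (parameterField (sparsePolynomial ((↑) : S₀ → ℕ) (c ∘ Sum.inl))
            (sparsePolynomial ((↑) : S₁ → ℕ) (c ∘ Sum.inr))) (RatFunc K) = 1 →
          RelationPolygonHasVertices
            (sparsePolynomial ((↑) : S₀ → ℕ) (c ∘ Sum.inl))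
            (sparsePolynomial ((↑) : S₁ → ℕ) (c ∘ Sum.inr))
            {((S₁.min' h₁ : ℝ), (0 : ℝ)), ((S₁.max' h₁ : ℝ), (0 : ℝ)),
              ((0 : ℝ), (S₀.max' h₀ : ℝ)), ((0 : ℝ), (S₀.min' h₀ : ℝ))}) := by
  have hmax₀ (k : S₀) : (k : ℕ) ≤ S₀.max' h₀ := S₀.le_max' k k.2
  have hmax₁ (k : S₁) : (k : ℕ) ≤ S₁.max' h₁ := S₁.le_max' k k.2
  constructor
  · intro h
    obtain ⟨F, hF, hpolygon⟩ := exists_forall_relationPolygonHasVertices (K := K) (a := 0) (b := 0)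
      (i₀ := ⟨_, S₀.max'_mem h₀⟩) (i₁ := ⟨_, S₁.max'_mem h₁⟩) Subtype.val_injective
      Subtype.val_injective hmax₀ hmax₁ (fun k => k.1.zero_le) (fun k => k.1.zero_le) Iff.rfl
      (h.imp (fun h => ⟨⟨0, h⟩, rfl⟩) fun h => ⟨⟨0, h⟩, rfl⟩) fun h => absurd rfl h
    refine ⟨F, hF, fun c hc hdeg => ?_⟩
    have hvertices := hpolygon c hc (IntermediateField.finrank_eq_one_iff_eq_top.1 hdeg)
    rwa [Nat.cast_zero, chordVertices_zero_zero] at hvertices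
  · intro hn₀ hn₁
    have hmin₀ : S₀.min' h₀ ≠ 0 := ne_of_mem_of_not_mem (S₀.min'_mem h₀) hn₀
    have hmin₁ : S₁.min' h₁ ≠ 0 := ne_of_mem_of_not_mem (S₁.min'_mem h₁) hn₁
    obtain ⟨F, hF, hpolygon⟩ := exists_forall_relationPolygonHasVertices (K := K)
      (i₀ := ⟨_, S₀.max'_mem h₀⟩) (i₁ := ⟨_, S₁.max'_mem h₁⟩) Subtype.val_injective
      Subtype.val_injective hmax₀ hmax₁ (fun k => S₀.min'_le k k.2) (fun k => S₁.min'_le k k.2)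
      (iff_of_false hmin₀ hmin₁) (.inl ⟨⟨_, S₀.min'_mem h₀⟩, rfl⟩)
      fun _ => ⟨⟨⟨_, S₀.min'_mem h₀⟩, rfl⟩, ⟨_, S₁.min'_mem h₁⟩, rfl⟩
    exact ⟨F, hF, fun c hc hdeg =>
      hpolygon c hc (IntermediateField.finrank_eq_one_iff_eq_top.1 hdeg)⟩
theorem theoremT (S₀ S₁ : Finset ℕ) (h₀ : S₀.Nonempty) (h₁ : S₁.Nonempty) :
    ((0 ∈ S₀ ∨ 0 ∈ S₁) →
      HoldsGenerically fun c : S₀ ⊕ S₁ → ℂ =>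
        paramDegree (polyOf S₀ fun k => c (Sum.inl k)) (polyOf S₁ fun k => c (Sum.inr k)) = 1 →
          ImplicitPolygonHasVertices
            (polyOf S₀ fun k => c (Sum.inl k)) (polyOf S₁ fun k => c (Sum.inr k))
            {((0 : ℝ), (0 : ℝ)), ((S₁.max' h₁ : ℝ), (0 : ℝ)), ((0 : ℝ), (S₀.max' h₀ : ℝ))}) ∧
    (0 ∉ S₀ → 0 ∉ S₁ →
      HoldsGenerically fun c : S₀ ⊕ S₁ → ℂ =>
        paramDegree (polyOf S₀ fun k => c (Sum.inl k)) (polyOf S₁ fun k => c (Sum.inr k)) = 1 →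
          ImplicitPolygonHasVertices
            (polyOf S₀ fun k => c (Sum.inl k)) (polyOf S₁ fun k => c (Sum.inr k))
            {((S₁.min' h₁ : ℝ), (0 : ℝ)), ((S₁.max' h₁ : ℝ), (0 : ℝ)),
              ((0 : ℝ), (S₀.max' h₀ : ℝ)), ((0 : ℝ), (S₀.min' h₀ : ℝ))}) :=
  theoremT_general S₀ S₁ h₀ h₁
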